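/- Let $N\subset M$ be an inclusion of finite factors (von Neumann factors on a complex Hilbert space, with the same unit, each carrying a faithful normal tracial state), and let $\tau$ be the canonical (faithful normal) tracial state of $M$. A Hopf $*$-algebra is a complex Hopf algebra $Q$ (comultiplication $\Delta h=h_1\otimes h_2$, counit $\varepsilon$, antipode $S$) that is also a unital $*$-algebra, such that $\Delta:Q\to Q\otimes Q$ is a $*$-morphism and $x\mapsto S(x)^*$ is an involution. Let $\mathrm{C}(N\subset M)$ be the category whose objects are the Hopf $*$-algebras $Q$ together with a $Q$-module structure on $M$ such that, for all $h\in Q$, $a,b\in M$, $n\in N$, $$h\cdot(ab)=(h_1\cdot a)(h_2\cdot b),\quad h\cdot 1=\varepsilon(h)1,\quad (h\cdot a)^*=S(h)^*\cdot a^*,\quad h\cdot n=\varepsilon(h)n,$$ and whose morphisms $Q\to Q'$ are the Hopf $*$-algebra morphisms $\phi$ with $\phi(h)\cdot a=h\cdot a$ for all $h\in Q$, $a\in M$. Let $\mathrm{C}_\tau(N\subset M)$ be the full subcategory of the objects whose action also satisfies $\tau(h\cdot a)=\varepsilon(h)\tau(a)$ for all $h\in Q$, $a\in M$. Then both quantum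 Galois groups exist: the category $\mathrm{C}(N\subset M)$ has a terminal object $\mathrm{QGal}(N\subset M)$, and the category $\mathrm{C}_\tau(N\subset M)$ has a terminal object $\mathrm{QGal}_\tau(N\subset M)$. -/

import Mathlib

open CategoryTheory
open scoped TensorProduct ComplexOrder

universe u

/-! ### Finite factors -/

section FiniteFactors

variable {H : Type u} [NormedAddCommGroup H] [InnerProductSpace ℂ H] [CompleteSpace H]

/-- A von Neumann algebra is a factor if its center consists of the scalars only. (That it is
not the zero algebra is part of `IsFiniteFactor`, through the normalization of the trace.) -/
def VonNeumannAlgebra.IsFactor (M : VonNeumannAlgebra H) : Prop :=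
  ∀ x ∈ M, (∀ y ∈ M, x * y = y * x) → ∃ c : ℂ, x = c • (1 : H →L[ℂ] H)

/-- The faithful normal tracial states on a von Neumann algebra `M`. On a factor there is at most
one of these, the canonical trace. Normality is the preservation of suprema of bounded increasing
nets of self-adjoint elements. -/
structure VonNeumannAlgebra.IsCanonicalTrace (M : VonNeumannAlgebra H)
    (τ : M.toStarSubalgebra →ₗ[ℂ] ℂ) : Prop where
  map_one : τ 1 = 1
  nonneg : ∀ x, 0 ≤ τ (star x * x)
  tracial : ∀ x y, τ (x * y) = τ (y * x)
  faithful : ∀ x, τ (star x * x) = 0 → x = 0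
  normal : ∀ D : Set M.toStarSubalgebra, (∀ x ∈ D, IsSelfAdjoint x) → D.Nonempty →
    DirectedOn (· ≤ ·) D → ∀ s, IsLUB D s → IsLUB ((fun x => (τ x).re) '' D) (τ s).re

/-- A finite factor (type `I_n` with `n` finite, or type `II_1`): a factor that carries a faithful
normal tracial state. -/
def VonNeumannAlgebra.IsFiniteFactor (M : VonNeumannAlgebra H) : Prop :=
  M.IsFactor ∧ ∃ τ : M.toStarSubalgebra →ₗ[ℂ] ℂ, M.IsCanonicalTrace τ

/-- `N`, seen as a star subalgebra of `M` (for `N ≤ M`). -/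
noncomputable def VonNeumannAlgebra.subalgebraIn (N M : VonNeumannAlgebra H) :
    StarSubalgebra ℂ M.toStarSubalgebra :=
  N.toStarSubalgebra.comap M.toStarSubalgebra.subtype

end FiniteFactors

/-! ### Hopf star-algebras and their actions -/

/-- A Hopf `*`-algebra: a complex Hopf algebra that is also a `*`-algebra, such that the
comultiplication is a `*`-morphism (for `star (a ⊗ b) = star a ⊗ star b`) and `x ↦ S(x)^*` is an
involution. -/
class HopfStarAlgebra (Q : Type u) [Ring Q] [StarRing Q] [HopfAlgebra ℂ Q] : Prop extends
    StarModule ℂ Q where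
  comul_star : ∀ x : Q, Coalgebra.comul (R := ℂ) (star x) = star (Coalgebra.comul (R := ℂ) x)
  star_antipode_star_antipode : ∀ x : Q,
    star (HopfAlgebra.antipode ℂ (star (HopfAlgebra.antipode ℂ x))) = x

section Actions

variable {Q A : Type u} [Ring Q] [StarRing Q] [HopfAlgebra ℂ Q]
  [Ring A] [StarRing A] [Algebra ℂ A]

/-- The module structure `ρ` of `A` over `Q` makes `A` a module `*`-algebra. -/
structure IsModuleStarAlgebra (ρ : Q →ₐ[ℂ] Module.End ℂ A) : Prop where
  /-- `h · 1 = ε(h) 1` -/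
  act_one : ∀ h : Q, ρ h 1 = Coalgebra.counit (R := ℂ) h • (1 : A)
  /-- `h · (a b) = (h₁ · a) (h₂ · b)` -/
  act_mul : ∀ (h : Q) (a b : A), ρ h (a * b) =
    LinearMap.mul' ℂ A (TensorProduct.map (ρ.toLinearMap.flip a) (ρ.toLinearMap.flip b)
      (Coalgebra.comul (R := ℂ) h))
  /-- `(h · a)^* = S(h)^* · a^*` -/
  star_act : ∀ (h : Q) (a : A), star (ρ h a) = ρ (star (HopfAlgebra.antipode ℂ h)) (star a)

end Actions

/-- Objects of the category `C(B ⊂ A)`, for a complex `*`-algebra `A` and a `*`-subalgebra `B`: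
Hopf `*`-algebras together with an action on `A` that makes it a module `*`-algebra and for which
every element of `B` is invariant. -/
structure GaloisAction (A : Type u) [Ring A] [StarRing A] [Algebra ℂ A] [StarModule ℂ A]
    (B : StarSubalgebra ℂ A) where
  carrier : Type u
  [ring : Ring carrier]
  [starRing : StarRing carrier]
  [hopfAlgebra : HopfAlgebra ℂ carrier]
  [hopfStarAlgebra : HopfStarAlgebra carrier]
  act : carrier →ₐ[ℂ] Module.End ℂ A
  isModuleStarAlgebra : IsModuleStarAlgebra act
  fixes : ∀ (h : carrier), ∀ b ∈ B, act h b = Coalgebra.counit (R := ℂ) h • b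

namespace GaloisAction

attribute [instance] ring starRing hopfAlgebra hopfStarAlgebra

variable {A : Type u} [Ring A] [StarRing A] [Algebra ℂ A] [StarModule ℂ A]
  {B : StarSubalgebra ℂ A}

/-- Morphisms: Hopf `*`-algebra morphisms that intertwine the actions. (A bialgebra morphism
between Hopf algebras commutes with the antipodes.) -/
@[ext]
structure Hom (X Y : GaloisAction A B) where
  toBialgHom : X.carrier →ₐc[ℂ] Y.carrier
  map_star : ∀ h, toBialgHom (star h) = star (toBialgHom h)
  act_map : ∀ h a, Y.act (toBialgHom h) a = X.act h a

/-- The category `C(B ⊂ A)`. -/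
instance : Category (GaloisAction A B) where
  Hom X Y := Hom X Y
  id X := ⟨BialgHom.id ℂ X.carrier, fun _ => rfl, fun _ _ => rfl⟩
  comp f g := ⟨g.toBialgHom.comp f.toBialgHom,
    fun h => by simp [f.map_star, g.map_star],
    fun h a => by simp [f.act_map, g.act_map]⟩

/-- The action preserves the functional `τ`: `τ(h · a) = ε(h) τ(a)`. -/
def Preserves (τ : A →ₗ[ℂ] ℂ) : ObjectProperty (GaloisAction A B) :=
  fun X => ∀ h a, τ (X.act h a) = Coalgebra.counit (R := ℂ) h * τ a

end GaloisAction

/-! ### Quantum Galois groups -/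

section QuantumGalois

variable {H : Type u} [NormedAddCommGroup H] [InnerProductSpace ℂ H] [CompleteSpace H]

/-- The category `C(N ⊂ M)`. -/
abbrev GaloisCat (N M : VonNeumannAlgebra H) : Type (u + 1) :=
  GaloisAction M.toStarSubalgebra (N.subalgebraIn M)

/-- The full subcategory `C_τ(N ⊂ M)` of `τ`-preserving actions. -/
abbrev GaloisTraceCat (N M : VonNeumannAlgebra H) (τ : M.toStarSubalgebra →ₗ[ℂ] ℂ) :
    Type (u + 1) :=
  (GaloisAction.Preserves (B := N.subalgebraIn M) τ).FullSubcategory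

/-- `Q` is a quantum Galois group `QGal(N ⊂ M)`. -/
def IsQGal (N M : VonNeumannAlgebra H) (Q : GaloisCat N M) : Prop :=
  Nonempty (Limits.IsTerminal Q)

/-- `Q` is a trace-preserving quantum Galois group `QGal_τ(N ⊂ M)`. -/
def IsQGalTrace (N M : VonNeumannAlgebra H) (τ : M.toStarSubalgebra →ₗ[ℂ] ℂ)
    (Q : GaloisTraceCat N M τ) : Prop :=
  Nonempty (Limits.IsTerminal Q)

end QuantumGalois

/-! The terminal object is the Hopf `*`-algebra generated by all acting ones, realized inside a
single algebra of coefficients. The image of `Q` in `End A` is too small to carry a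
comultiplication, since the kernel of an action need not be a coideal. So every formal composite `i`
of counit, action, `Δ`, `S` and `*` is recorded: it gives an algebra morphism from `Q` to an algebra
`Coeff A i` that depends on `A` only. Hence the large family of all actions with a property `P` has
images in one algebra `∏ i, Coeff A i` in `Type u`, and `Universal P` is the subalgebra they
generate.

On this product `S`, `*` and the action are read off by shifting or evaluating the index. For `Δ`,
the entry of `Δ t` at `(i, j)` must be the entry of `t` at `comul i j`; `tensorProj_injective` makes
this a definition and `comulProj_mem_range` shows that such a tensor exists. The axioms hold on
generators because they hold in each action, and they pass to sums and products.

Uniqueness: morphisms preserve coefficients (`coeff_map`), those of the universal object are the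
coordinate projections (`coeff_universal`), and these separate points. -/

/-! ### Preliminaries on tensor products, bialgebra morphisms and star structures -/

namespace TensorProduct

/-- A jointly injective family of linear maps on the right factor stays jointly injective after
tensoring with a vector space. -/
theorem eq_zero_of_forall_lTensor {K V W ι : Type*} [Field K] [AddCommGroup V] [Module K V]
    [AddCommGroup W] [Module K W] {E : ι → Type*} [∀ i, AddCommGroup (E i)] [∀ i, Module K (E i)]
    (f : ∀ i, W →ₗ[K] E i) (hf : ∀ w, (∀ i, f i w = 0) → w = 0) (t : V ⊗[K] W)
    (ht : ∀ i, (f i).lTensor V t = 0) : t = 0 := by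
  classical
  -- In coordinates along a basis of `V`, a tensor is a finitely supported family in `W`, and
  -- `lTensor` acts on each entry separately.
  let b := Module.Basis.ofVectorSpace K V
  have key : ∀ i (s : V ⊗[K] W) k, equivFinsuppOfBasisLeft b ((f i).lTensor V s) k =
      f i (equivFinsuppOfBasisLeft b s k) := by
    intro i s k
    induction s with
    | zero => simp
    | tmul v w => simp
    | add x y hx hy => simp [hx, hy]
  apply (equivFinsuppOfBasisLeft b).injective
  ext k
  simp only [map_zero, Finsupp.coe_zero, Pi.zero_apply]
  refine hf _ fun i => ?_
  rw [← key, ht, map_zero, Finsupp.zero_apply]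

theorem eq_zero_of_forall_rTensor {K V W ι : Type*} [Field K] [AddCommGroup V] [Module K V]
    [AddCommGroup W] [Module K W] {E : ι → Type*} [∀ i, AddCommGroup (E i)] [∀ i, Module K (E i)]
    (f : ∀ i, W →ₗ[K] E i) (hf : ∀ w, (∀ i, f i w = 0) → w = 0) (t : W ⊗[K] V)
    (ht : ∀ i, (f i).rTensor V t = 0) : t = 0 := by
  apply (TensorProduct.comm K W V).injective
  rw [map_zero]
  refine eq_zero_of_forall_lTensor f hf _ fun i => ?_
  have : (f i).lTensor V (TensorProduct.comm K W V t) =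
      TensorProduct.comm K (E i) V ((f i).rTensor V t) := by
    simp [LinearMap.lTensor, LinearMap.rTensor, ← TensorProduct.map_comm]
  rw [this, ht, map_zero]

/-- The tensor products of two jointly injective families are jointly injective. -/
theorem eq_zero_of_forall_map {K V W ι κ : Type*} [Field K] [AddCommGroup V] [Module K V]
    [AddCommGroup W] [Module K W] {D : ι → Type*} [∀ i, AddCommGroup (D i)] [∀ i, Module K (D i)]
    {E : κ → Type*} [∀ i, AddCommGroup (E i)] [∀ i, Module K (E i)]
    (f : ∀ i, V →ₗ[K] D i) (hf : ∀ v, (∀ i, f i v = 0) → v = 0)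
    (g : ∀ i, W →ₗ[K] E i) (hg : ∀ w, (∀ i, g i w = 0) → w = 0) (t : V ⊗[K] W)
    (ht : ∀ i j, TensorProduct.map (f i) (g j) t = 0) : t = 0 := by
  refine eq_zero_of_forall_lTensor g hg t fun j => eq_zero_of_forall_rTensor f hf _ fun i => ?_
  rw [← LinearMap.comp_apply, LinearMap.rTensor_comp_lTensor]
  exact ht i j

theorem star_mul_of_starRing {R A B : Type*} [CommSemiring R] [StarRing R]
    [Semiring A] [StarRing A] [Algebra R A] [StarModule R A]
    [Semiring B] [StarRing B] [Algebra R B] [StarModule R B] (x y : A ⊗[R] B) :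
    star (x * y) = star y * star x := by
  induction x with
  | zero => simp
  | add a b ha hb => simp [add_mul, mul_add, ha, hb]
  | tmul a b =>
    induction y with
    | zero => simp
    | add c d hc hd => simp [add_mul, mul_add, hc, hd]
    | tmul c d => simp

end TensorProduct

/-- A bialgebra morphism between Hopf algebras commutes with the antipodes. -/
theorem BialgHom.map_antipode {R A B : Type*} [CommSemiring R] [Semiring A] [Semiring B]
    [HopfAlgebra R A] [HopfAlgebra R B] (f : A →ₐc[R] B) (a : A) :
    f (HopfAlgebra.antipode R a) = HopfAlgebra.antipode R (f a) := by
  suffices h : (f : A →ₐ[R] B).toLinearMap ∘ₗ HopfAlgebra.antipode R =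
      HopfAlgebra.antipode R ∘ₗ (f : A →ₐ[R] B).toLinearMap from LinearMap.congr_fun h a
  apply WithConv.toConv_injective
  -- `f ∘ S` is a left and `S ∘ f` a right convolution inverse of `f`.
  apply left_inv_eq_right_inv (a := WithConv.toConv (f : A →ₐ[R] B).toLinearMap)
  · ext c
    rw [(Coalgebra.Repr.arbitrary R c).convMul_apply]
    simp [← map_mul, ← map_sum, HopfAlgebra.sum_antipode_mul_eq_algebraMap_counit]
    exact AlgHomClass.commutes f _
  · ext c
    rw [(Coalgebra.Repr.arbitrary R c).convMul_apply]
    simpa using HopfAlgebra.sum_mul_antipode_eq_algebraMap_counit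
      ((Coalgebra.Repr.arbitrary R c).induced f)

/-! ### The algebra of all matrix coefficients -/

/-- The opposite of a complex algebra, with the conjugate scalar action. -/
def ConjOpposite (R : Type*) : Type _ := Rᵐᵒᵖ

namespace ConjOpposite

variable {R : Type*}

/-- The identity map onto the conjugate opposite. -/
def conjOp (x : R) : ConjOpposite R := MulOpposite.op x

/-- The identity map from the conjugate opposite. -/
def unconjOp (x : ConjOpposite R) : R := MulOpposite.unop x

variable [Ring R]

instance : Ring (ConjOpposite R) := inferInstanceAs (Ring Rᵐᵒᵖ)

@[simp] theorem conjOp_one : conjOp (1 : R) = 1 := rfl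

@[simp] theorem conjOp_zero : conjOp (0 : R) = 0 := rfl

@[simp] theorem conjOp_add (x y : R) : conjOp (x + y) = conjOp x + conjOp y := rfl

@[simp] theorem conjOp_mul (x y : R) : conjOp (x * y) = conjOp y * conjOp x := rfl

variable [Algebra ℂ R]

/-- With products reversed and scalars conjugated, an antilinear antimultiplicative map becomes an
algebra morphism, so `*` can be treated like the other structure maps. -/
noncomputable instance : Algebra ℂ (ConjOpposite R) :=
  ((algebraMap ℂ Rᵐᵒᵖ).comp (starRingEnd ℂ)).toAlgebra' fun c x =>
    Algebra.commutes (A := Rᵐᵒᵖ) (starRingEnd ℂ c) x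

theorem algebraMap_apply (c : ℂ) :
    algebraMap ℂ (ConjOpposite R) c = conjOp (algebraMap ℂ R (star c)) := rfl

end ConjOpposite

/-- Formal composites of the structure maps of a Hopf `*`-algebra that acts on something. -/
inductive CoefficientIndex : Type
  | counit
  | act
  | comul (i j : CoefficientIndex)
  | antipode (i : CoefficientIndex)
  | star (i : CoefficientIndex)

namespace GaloisAction

open MulOpposite ConjOpposite

section Coefficients

variable (A : Type u) [Ring A] [Algebra ℂ A]

/-- The algebra in which a formal composite of structure maps takes its values. -/
noncomputable def Coeff : CoefficientIndex → AlgCat.{u} ℂ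
  -- Bundling in `AlgCat` lets the recursion carry the algebra structure along with the type;
  -- `ULift` puts `ℂ` into the universe of `A`.
  | .counit => AlgCat.of ℂ (ULift.{u} ℂ)
  | .act => AlgCat.of ℂ (Module.End ℂ A)
  | .comul i j => AlgCat.of ℂ (Coeff i ⊗[ℂ] Coeff j)
  | .antipode i => AlgCat.of ℂ (Coeff i)ᵐᵒᵖ
  | .star i => AlgCat.of ℂ (ConjOpposite (Coeff i))

variable {A}

/-- The antipode in terms of coefficients. -/
noncomputable def coeffAntipode : (∀ i, Coeff A i) →ₗ[ℂ] ∀ i, Coeff A i where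
  toFun t i := unop (t (.antipode i))
  map_add' _ _ := rfl
  map_smul' _ _ := rfl

theorem coeffAntipode_mul (s t : ∀ i, Coeff A i) :
    coeffAntipode (s * t) = coeffAntipode t * coeffAntipode s := rfl

theorem coeffAntipode_algebraMap (c : ℂ) :
    coeffAntipode (algebraMap ℂ (∀ i, Coeff A i) c) = algebraMap ℂ (∀ i, Coeff A i) c := rfl

/-- The star operation in terms of coefficients. -/
noncomputable def coeffStar (t : ∀ i, Coeff A i) : ∀ i, Coeff A i := fun i => unconjOp (t (.star i))

theorem coeffStar_add (s t : ∀ i, Coeff A i) : coeffStar (s + t) = coeffStar s + coeffStar t := rfl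

theorem coeffStar_mul (s t : ∀ i, Coeff A i) : coeffStar (s * t) = coeffStar t * coeffStar s := rfl

theorem coeffStar_algebraMap (c : ℂ) : coeffStar (algebraMap ℂ (∀ i, Coeff A i) c) =
    algebraMap ℂ (∀ i, Coeff A i) (Star.star c) := rfl

end Coefficients

variable {A : Type u} [Ring A] [StarRing A] [Algebra ℂ A] [StarModule ℂ A]
  {B : StarSubalgebra ℂ A}

/-- The composite of an algebra morphism with the involution. -/
noncomputable def compStar {Q R : Type*} [Ring Q] [StarRing Q] [Algebra ℂ Q] [StarModule ℂ Q]
    [Ring R] [Algebra ℂ R] (f : Q →ₐ[ℂ] R) : Q →ₐ[ℂ] ConjOpposite R where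
  toFun h := conjOp (f (Star.star h))
  map_one' := by simp
  map_mul' x y := by simp
  map_zero' := by simp
  map_add' x y := by simp
  commutes' c := by rw [← algebraMap_star_comm, AlgHom.commutes, ConjOpposite.algebraMap_apply]

/-- The composites of the structure maps of an acting Hopf `*`-algebra. -/
noncomputable def coeff (X : GaloisAction A B) : ∀ i, X.carrier →ₐ[ℂ] Coeff A i
  | .counit => (ULift.algEquiv (R := ℂ) (A := ℂ)).symm.toAlgHom.comp
      (Bialgebra.counitAlgHom ℂ X.carrier)
  | .act => X.act
  | .comul i j => (Algebra.TensorProduct.map (X.coeff i) (X.coeff j)).comp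
      (Bialgebra.comulAlgHom ℂ X.carrier)
  | .antipode i => (AlgHom.op (X.coeff i)).comp (HopfAlgebra.antipodeAlgHomOp ℂ X.carrier)
  | .star i => compStar (X.coeff i)

/-- All coefficients together. -/
noncomputable def coeffs (X : GaloisAction A B) : X.carrier →ₐ[ℂ] ∀ i, Coeff A i :=
  AlgHom.pi X.coeff

/-- A morphism preserves all coefficients. -/
theorem coeff_map {X Y : GaloisAction A B} (f : Hom X Y) (i : CoefficientIndex) :
    ∀ h, Y.coeff i (f.toBialgHom h) = X.coeff i h := by
  induction i with
  | counit =>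
    intro h
    change ULift.up _ = ULift.up _
    simp
  | act => exact fun h => LinearMap.ext (f.act_map h)
  | comul i j hi hj =>
    intro h
    change Algebra.TensorProduct.map (Y.coeff i) (Y.coeff j) (Coalgebra.comul (f.toBialgHom h)) =
      Algebra.TensorProduct.map (X.coeff i) (X.coeff j) (Coalgebra.comul h)
    rw [← CoalgHomClass.map_comp_comul_apply]
    induction Coalgebra.comul (R := ℂ) h with
    | zero => simp
    | add x y hx hy => rw [map_add, map_add, hx, hy, map_add]
    | tmul x y => simp [hi, hj]
  | antipode i hi =>
    intro h
    change op (Y.coeff i (HopfAlgebra.antipode ℂ (f.toBialgHom h))) =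
      op (X.coeff i (HopfAlgebra.antipode ℂ h))
    rw [← BialgHom.map_antipode, hi]
  | star i hi =>
    intro h
    change conjOp (Y.coeff i (Star.star (f.toBialgHom h))) = conjOp (X.coeff i (Star.star h))
    rw [← f.map_star, hi]

end GaloisAction

/-! ### The universal Hopf star-algebra -/

namespace GaloisAction

open MulOpposite ConjOpposite

variable {A : Type u} [Ring A] [StarRing A] [Algebra ℂ A] [StarModule ℂ A]
  {B : StarSubalgebra ℂ A}

/-- The algebra generated by the coefficients of all actions with a given property. -/
noncomputable def universalSubalgebra (P : GaloisAction A B → Prop) :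
    Subalgebra ℂ (∀ i, Coeff A i) :=
  Algebra.adjoin ℂ {t | ∃ X, P X ∧ ∃ h, X.coeffs h = t}

/-- The algebra generated by the coefficients of all actions with a given property, as a type. -/
def Universal (P : GaloisAction A B → Prop) : Type u := universalSubalgebra P

namespace Universal

variable {P : GaloisAction A B → Prop}

noncomputable instance : Ring (Universal P) := inferInstanceAs (Ring (universalSubalgebra P))

noncomputable instance : Algebra ℂ (Universal P) :=
  inferInstanceAs (Algebra ℂ (universalSubalgebra P))

/-- The inclusion into the algebra of all coefficients. -/
noncomputable def incl : Universal P →ₐ[ℂ] ∀ i, Coeff A i := (universalSubalgebra P).val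

theorem incl_injective : Function.Injective (incl (P := P)) := Subtype.val_injective

/-- The coefficient at one index. -/
noncomputable def proj (i : CoefficientIndex) : Universal P →ₐ[ℂ] Coeff A i :=
  (Pi.evalAlgHom ℂ _ i).comp incl

theorem ext_proj {s t : Universal P} (h : ∀ i, proj i s = proj i t) : s = t :=
  incl_injective (funext h)

theorem coeffs_mem (X : GaloisAction A B) (hX : P X) (h : X.carrier) :
    X.coeffs h ∈ universalSubalgebra P :=
  Algebra.subset_adjoin ⟨X, hX, h, rfl⟩

/-- The coefficients of an action, as a morphism to the universal algebra. -/
noncomputable def ofAction (X : GaloisAction A B) (hX : P X) : X.carrier →ₐ[ℂ] Universal P :=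
  X.coeffs.codRestrict (universalSubalgebra P) (coeffs_mem X hX)

@[simp] theorem incl_ofAction (X : GaloisAction A B) (hX : P X) (h : X.carrier) :
    incl (ofAction X hX h) = X.coeffs h := rfl

-- Reduces each structural identity to the images of the actions, where it is an axiom, plus
-- stability under sums and products.
@[elab_as_elim]
theorem induction {p : Universal P → Prop}
    (ofAction : ∀ (X : GaloisAction A B) (hX : P X) h, p (ofAction X hX h))
    (algebraMap : ∀ c : ℂ, p (algebraMap ℂ (Universal P) c))
    (add : ∀ s t, p s → p t → p (s + t)) (mul : ∀ s t, p s → p t → p (s * t))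
    (t : Universal P) : p t := by
  obtain ⟨t, ht⟩ := t
  refine Algebra.adjoin_induction (p := fun t ht => p ⟨t, ht⟩) ?_ algebraMap
    (fun x y hx hy => add ⟨x, hx⟩ ⟨y, hy⟩) (fun x y hx hy => mul ⟨x, hx⟩ ⟨y, hy⟩) ht
  rintro _ ⟨X, hX, h, rfl⟩
  exact ofAction X hX h

theorem algHom_ext {R : Type*} [Semiring R] [Algebra ℂ R] {f g : Universal P →ₐ[ℂ] R}
    (h : ∀ (X : GaloisAction A B) (hX : P X) x, f (ofAction X hX x) = g (ofAction X hX x)) :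
    f = g := by
  ext t
  induction t using Universal.induction with
  | ofAction X hX x => exact h X hX x
  | algebraMap c => simp
  | add s t hs ht => simp [hs, ht]
  | mul s t hs ht => simp [hs, ht]

/-! #### Comultiplication and counit -/

/-- The coefficients of a tensor. -/
noncomputable def tensorProj : Universal P ⊗[ℂ] Universal P →ₐ[ℂ]
    ∀ p : CoefficientIndex × CoefficientIndex, Coeff A p.1 ⊗[ℂ] Coeff A p.2 :=
  AlgHom.pi fun p => Algebra.TensorProduct.map (proj p.1) (proj p.2)

/-- The projections are jointly injective, and over a field this survives tensoring. A tensor may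
thus be specified by its coefficients. -/
theorem tensorProj_injective : Function.Injective (tensorProj (P := P)) := by
  rw [injective_iff_map_eq_zero]
  intro t ht
  have hp : ∀ v : Universal P, (∀ i, (proj i).toLinearMap v = 0) → v = 0 := fun v hv =>
    ext_proj fun i => (hv i).trans (map_zero _).symm
  exact TensorProduct.eq_zero_of_forall_map (fun i => (proj i).toLinearMap) hp
    (fun i => (proj i).toLinearMap) hp t fun i j => congrFun ht (i, j)

/-- The comultiplication in terms of coefficients. -/
noncomputable def comulProj : Universal P →ₐ[ℂ]
    ∀ p : CoefficientIndex × CoefficientIndex, Coeff A p.1 ⊗[ℂ] Coeff A p.2 :=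
  AlgHom.pi fun p => proj (.comul p.1 p.2)

theorem tensorProj_map_ofAction (X : GaloisAction A B) (hX : P X) (h : X.carrier) :
    tensorProj (Algebra.TensorProduct.map (ofAction X hX) (ofAction X hX)
      (Coalgebra.comul (R := ℂ) h)) = comulProj (ofAction X hX h) := by
  ext p
  change Algebra.TensorProduct.map (proj p.1) (proj p.2) (Algebra.TensorProduct.map
    (ofAction X hX) (ofAction X hX) (Coalgebra.comul (R := ℂ) h)) =
    Algebra.TensorProduct.map (X.coeff p.1) (X.coeff p.2) (Coalgebra.comul (R := ℂ) h)
  rw [← AlgHom.comp_apply, ← Algebra.TensorProduct.map_comp]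
  rfl

/-- The range is a subalgebra, and on generators the comultiplication of the action supplies a
preimage. -/
theorem comulProj_mem_range (t : Universal P) : comulProj t ∈ (tensorProj (P := P)).range := by
  induction t using Universal.induction with
  | ofAction X hX h => exact ⟨_, tensorProj_map_ofAction X hX h⟩
  | algebraMap c => rw [AlgHom.commutes]; exact Subalgebra.algebraMap_mem _ c
  | add s t hs ht => rw [map_add]; exact add_mem hs ht
  | mul s t hs ht => rw [map_mul]; exact mul_mem hs ht

/-- The comultiplication of the universal algebra. -/
noncomputable def comulHom : Universal P →ₐ[ℂ] Universal P ⊗[ℂ] Universal P :=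
  (AlgEquiv.ofInjective tensorProj tensorProj_injective).symm.toAlgHom.comp
    (comulProj.codRestrict _ comulProj_mem_range)

theorem tensorProj_comulHom (t : Universal P) : tensorProj (comulHom t) = comulProj t :=
  congrArg Subtype.val ((AlgEquiv.ofInjective tensorProj tensorProj_injective).apply_symm_apply
    (comulProj.codRestrict _ comulProj_mem_range t))

theorem comulHom_ofAction (X : GaloisAction A B) (hX : P X) (h : X.carrier) :
    comulHom (ofAction X hX h) = Algebra.TensorProduct.map (ofAction X hX) (ofAction X hX)
      (Coalgebra.comul (R := ℂ) h) :=
  tensorProj_injective ((tensorProj_comulHom _).trans (tensorProj_map_ofAction X hX h).symm)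

/-- The counit of the universal algebra. -/
noncomputable def counitHom : Universal P →ₐ[ℂ] ℂ :=
  (ULift.algEquiv (R := ℂ) (A := ℂ)).toAlgHom.comp (proj .counit)

theorem counitHom_ofAction (X : GaloisAction A B) (hX : P X) (h : X.carrier) :
    counitHom (ofAction X hX h) = Coalgebra.counit (R := ℂ) h := rfl

theorem counitHom_comp_ofAction (X : GaloisAction A B) (hX : P X) :
    counitHom.comp (ofAction X hX) = Bialgebra.counitAlgHom ℂ X.carrier := rfl

theorem comulHom_comp_ofAction (X : GaloisAction A B) (hX : P X) :
    comulHom.comp (ofAction X hX) = (Algebra.TensorProduct.map (ofAction X hX)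
      (ofAction X hX)).comp (Bialgebra.comulAlgHom ℂ X.carrier) :=
  AlgHom.ext (comulHom_ofAction X hX)

noncomputable instance : Bialgebra ℂ (Universal P) :=
  Bialgebra.ofAlgHom comulHom counitHom
    (algHom_ext fun X hX h => by
      -- Coassociativity in `X`, pushed forward along the threefold tensor power of `ofAction`.
      have e := congrArg (Algebra.TensorProduct.map (ofAction X hX)
        (Algebra.TensorProduct.map (ofAction X hX) (ofAction X hX)))
        (Coalgebra.coassoc_apply (R := ℂ) h)
      simp only [AlgHom.comp_apply, comulHom_ofAction]
      convert e using 1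
      · induction Coalgebra.comul (R := ℂ) h with
        | zero => simp
        | add x y hx hy => simp only [map_add, hx, hy]
        | tmul x y =>
          simp only [Algebra.TensorProduct.map_tmul, comulHom_ofAction, AlgHom.id_apply,
            LinearMap.rTensor_tmul]
          induction Coalgebra.comul (R := ℂ) x with
          | zero => simp
          | add x y hx hy => simp only [map_add, hx, hy, TensorProduct.add_tmul]
          | tmul x y => simp
      · induction Coalgebra.comul (R := ℂ) h with
        | zero => simp
        | add x y hx hy => simp only [map_add, hx, hy]
        | tmul x y => simp [comulHom_ofAction])
    (algHom_ext fun X hX h => by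
      have e := congrArg (Algebra.TensorProduct.map (AlgHom.id ℂ ℂ) (ofAction X hX))
        (Coalgebra.rTensor_counit_comul (R := ℂ) h)
      simp only [AlgHom.comp_apply, comulHom_ofAction]
      convert e using 1
      · induction Coalgebra.comul (R := ℂ) h with
        | zero => simp
        | add x y hx hy => simp only [map_add, hx, hy]
        | tmul x y => simp [counitHom_ofAction]
      · simp)
    (algHom_ext fun X hX h => by
      have e := congrArg (Algebra.TensorProduct.map (ofAction X hX) (AlgHom.id ℂ ℂ))
        (Coalgebra.lTensor_counit_comul (R := ℂ) h)
      simp only [AlgHom.comp_apply, comulHom_ofAction]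
      convert e using 1
      · induction Coalgebra.comul (R := ℂ) h with
        | zero => simp
        | add x y hx hy => simp only [map_add, hx, hy]
        | tmul x y => simp [counitHom_ofAction]
      · simp)

theorem comul_ofAction (X : GaloisAction A B) (hX : P X) (h : X.carrier) :
    Coalgebra.comul (R := ℂ) (ofAction X hX h) =
      Algebra.TensorProduct.map (ofAction X hX) (ofAction X hX) (Coalgebra.comul (R := ℂ) h) :=
  comulHom_ofAction X hX h

@[simp] theorem counit_ofAction (X : GaloisAction A B) (hX : P X) (h : X.carrier) :
    Coalgebra.counit (R := ℂ) (ofAction X hX h) = Coalgebra.counit (R := ℂ) h := rfl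

/-! #### Antipode -/

/-- By definition, the entry of `h` at `antipode i` is the entry of `S h` at `i`. -/
theorem coeffAntipode_coeffs (X : GaloisAction A B) (h : X.carrier) :
    coeffAntipode (X.coeffs h) = X.coeffs (HopfAlgebra.antipode ℂ h) := rfl

theorem coeffAntipode_incl_mem (t : Universal P) :
    coeffAntipode (incl t) ∈ universalSubalgebra P := by
  induction t using Universal.induction with
  | ofAction X hX h =>
    rw [incl_ofAction, coeffAntipode_coeffs]
    exact coeffs_mem X hX _
  | algebraMap c =>
    rw [AlgHom.commutes, coeffAntipode_algebraMap]
    exact Subalgebra.algebraMap_mem _ c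
  | add s t hs ht => rw [map_add, map_add]; exact add_mem hs ht
  | mul s t hs ht => rw [map_mul, coeffAntipode_mul]; exact mul_mem ht hs

/-- The antipode of the universal algebra. -/
noncomputable def antipodeMap : Universal P →ₗ[ℂ] Universal P :=
  (coeffAntipode ∘ₗ incl.toLinearMap).codRestrict
    (Subalgebra.toSubmodule (universalSubalgebra P)) coeffAntipode_incl_mem

theorem antipodeMap_mul (s t : Universal P) :
    antipodeMap (s * t) = antipodeMap t * antipodeMap s := rfl

theorem antipodeMap_one : antipodeMap (1 : Universal P) = 1 := rfl

theorem antipodeMap_algebraMap (c : ℂ) :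
    antipodeMap (algebraMap ℂ (Universal P) c) = algebraMap ℂ (Universal P) c := rfl

theorem antipodeMap_ofAction (X : GaloisAction A B) (hX : P X) (h : X.carrier) :
    antipodeMap (ofAction X hX h) = ofAction X hX (HopfAlgebra.antipode ℂ h) := rfl

/-- In `S(x₁ y₁) x₂ y₂ = S(y₁) (S(x₁) x₂) y₂` the inner factor is a scalar and moves out. This
carries the antipode axiom from two elements to their product. -/
theorem mul_rTensor_antipodeMap_mul (x y : Universal P ⊗[ℂ] Universal P) (c : ℂ)
    (hx : LinearMap.mul' ℂ _ (antipodeMap.rTensor _ x) = algebraMap ℂ (Universal P) c) :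
    LinearMap.mul' ℂ _ (antipodeMap.rTensor _ (x * y)) =
      c • LinearMap.mul' ℂ _ (antipodeMap.rTensor _ y) := by
  induction y with
  | zero => simp
  | add y z hy hz => rw [mul_add, map_add, map_add, hy, hz, map_add, map_add, smul_add]
  | tmul a b =>
    have key : LinearMap.mul' ℂ _ (antipodeMap.rTensor _ (x * a ⊗ₜ b)) =
        antipodeMap a * LinearMap.mul' ℂ _ (antipodeMap.rTensor _ x) * b := by
      clear hx
      induction x with
      | zero => simp
      | add y z hy hz => rw [add_mul, map_add, map_add, hy, hz, map_add, map_add, mul_add, add_mul]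
      | tmul d e => simp [antipodeMap_mul, mul_assoc]
    rw [key, hx, ← Algebra.commutes, mul_assoc, ← Algebra.smul_def]
    simp

theorem mul_lTensor_antipodeMap_mul (x y : Universal P ⊗[ℂ] Universal P) (c : ℂ)
    (hy : LinearMap.mul' ℂ _ (antipodeMap.lTensor _ y) = algebraMap ℂ (Universal P) c) :
    LinearMap.mul' ℂ _ (antipodeMap.lTensor _ (x * y)) =
      c • LinearMap.mul' ℂ _ (antipodeMap.lTensor _ x) := by
  induction x with
  | zero => simp
  | add x z hx hz => rw [add_mul, map_add, map_add, hx, hz, map_add, map_add, smul_add]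
  | tmul a b =>
    have key : LinearMap.mul' ℂ _ (antipodeMap.lTensor _ (a ⊗ₜ b * y)) =
        a * LinearMap.mul' ℂ _ (antipodeMap.lTensor _ y) * antipodeMap b := by
      clear hy
      induction y with
      | zero => simp
      | add y z hy hz => rw [mul_add, map_add, map_add, hy, hz, map_add, map_add, mul_add, add_mul]
      | tmul d e => simp [antipodeMap_mul, mul_assoc]
    rw [key, hy, ← Algebra.commutes, mul_assoc, ← Algebra.smul_def]
    simp

theorem mul_rTensor_antipodeMap_comul (t : Universal P) :
    LinearMap.mul' ℂ _ (antipodeMap.rTensor _ (Coalgebra.comul (R := ℂ) t)) =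
      algebraMap ℂ (Universal P) (Coalgebra.counit (R := ℂ) t) := by
  induction t using Universal.induction with
  | ofAction X hX h =>
    have e := congrArg (ofAction X hX) (HopfAlgebra.mul_antipode_rTensor_comul_apply (R := ℂ) h)
    rw [AlgHom.commutes] at e
    rw [comul_ofAction, counit_ofAction, ← e]
    induction Coalgebra.comul (R := ℂ) h with
    | zero => simp
    | add x y hx hy => simp only [map_add, hx, hy]
    | tmul x y => simp [antipodeMap_ofAction]
  | algebraMap c => simp [Algebra.TensorProduct.algebraMap_apply, antipodeMap_algebraMap]
  | add s t hs ht => simp only [map_add, hs, ht]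
  | mul s t hs ht =>
    rw [Bialgebra.comul_mul, mul_rTensor_antipodeMap_mul _ _ _ hs, ht, Bialgebra.counit_mul,
      map_mul, Algebra.smul_def]

theorem mul_lTensor_antipodeMap_comul (t : Universal P) :
    LinearMap.mul' ℂ _ (antipodeMap.lTensor _ (Coalgebra.comul (R := ℂ) t)) =
      algebraMap ℂ (Universal P) (Coalgebra.counit (R := ℂ) t) := by
  induction t using Universal.induction with
  | ofAction X hX h =>
    have e := congrArg (ofAction X hX) (HopfAlgebra.mul_antipode_lTensor_comul_apply (R := ℂ) h)
    rw [AlgHom.commutes] at e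
    rw [comul_ofAction, counit_ofAction, ← e]
    induction Coalgebra.comul (R := ℂ) h with
    | zero => simp
    | add x y hx hy => simp only [map_add, hx, hy]
    | tmul x y => simp [antipodeMap_ofAction]
  | algebraMap c => simp [Algebra.TensorProduct.algebraMap_apply, antipodeMap_one]
  | add s t hs ht => simp only [map_add, hs, ht]
  | mul s t hs ht =>
    -- In `s₁ t₁ S(t₂) S(s₂)` the factor from `t` collapses first, so the counits come out in the
    -- opposite order.
    rw [Bialgebra.comul_mul, mul_lTensor_antipodeMap_mul _ _ _ ht, hs, Bialgebra.counit_mul,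
      mul_comm, map_mul, Algebra.smul_def]

noncomputable instance : HopfAlgebra ℂ (Universal P) where
  antipode := antipodeMap
  mul_antipode_rTensor_comul := LinearMap.ext mul_rTensor_antipodeMap_comul
  mul_antipode_lTensor_comul := LinearMap.ext mul_lTensor_antipodeMap_comul

theorem antipode_mul (s t : Universal P) : HopfAlgebra.antipode ℂ (s * t) =
    HopfAlgebra.antipode ℂ t * HopfAlgebra.antipode ℂ s := rfl

@[simp] theorem antipode_algebraMap (c : ℂ) :
    HopfAlgebra.antipode ℂ (algebraMap ℂ (Universal P) c) = algebraMap ℂ (Universal P) c := rfl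

@[simp] theorem antipode_ofAction (X : GaloisAction A B) (hX : P X) (h : X.carrier) :
    HopfAlgebra.antipode ℂ (ofAction X hX h) = ofAction X hX (HopfAlgebra.antipode ℂ h) := rfl

/-! #### Star operation -/

theorem coeffStar_coeffs (X : GaloisAction A B) (h : X.carrier) :
    coeffStar (X.coeffs h) = X.coeffs (star h) := rfl

theorem coeffStar_incl_mem (t : Universal P) : coeffStar (incl t) ∈ universalSubalgebra P := by
  induction t using Universal.induction with
  | ofAction X hX h =>
    rw [incl_ofAction, coeffStar_coeffs]
    exact coeffs_mem X hX _
  | algebraMap c =>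
    rw [AlgHom.commutes, coeffStar_algebraMap]
    exact Subalgebra.algebraMap_mem _ (star c)
  | add s t hs ht => rw [map_add, coeffStar_add]; exact add_mem hs ht
  | mul s t hs ht => rw [map_mul, coeffStar_mul]; exact mul_mem ht hs

noncomputable instance : Star (Universal P) where
  star t := ⟨coeffStar (incl t), coeffStar_incl_mem t⟩

theorem star_ofAction (X : GaloisAction A B) (hX : P X) (h : X.carrier) :
    star (ofAction X hX h) = ofAction X hX (star h) := rfl

theorem star_add_eq (s t : Universal P) : star (s + t) = star s + star t := rfl

theorem star_mul_eq (s t : Universal P) : star (s * t) = star t * star s := rfl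

theorem star_algebraMap (c : ℂ) :
    star (algebraMap ℂ (Universal P) c) = algebraMap ℂ (Universal P) (star c) := rfl

noncomputable instance : StarRing (Universal P) where
  star_involutive t := by
    induction t using Universal.induction with
    | ofAction X hX h => rw [star_ofAction, star_ofAction, star_star]
    | algebraMap c => rw [star_algebraMap, star_algebraMap, star_star]
    | add s t hs ht => rw [star_add_eq, star_add_eq, hs, ht]
    | mul s t hs ht => rw [star_mul_eq, star_mul_eq, hs, ht]
  star_mul := star_mul_eq
  star_add := star_add_eq

instance : StarModule ℂ (Universal P) where
  star_smul c t := by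
    rw [Algebra.smul_def, star_mul, star_algebraMap, ← Algebra.commutes, ← Algebra.smul_def]

instance : HopfStarAlgebra (Universal P) where
  comul_star t := by
    induction t using Universal.induction with
    | ofAction X hX h =>
      rw [star_ofAction, comul_ofAction, comul_ofAction, HopfStarAlgebra.comul_star]
      induction Coalgebra.comul (R := ℂ) h with
      | zero => simp
      | add x y hx hy => simp only [map_add, star_add, hx, hy]
      | tmul x y => simp [star_ofAction]
    | algebraMap c =>
      rw [star_algebraMap, Bialgebra.comul_algebraMap, Bialgebra.comul_algebraMap]
      simp [Algebra.TensorProduct.algebraMap_apply, star_algebraMap]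
    | add s t hs ht => simp only [map_add, star_add, hs, ht]
    | mul s t hs ht =>
      rw [star_mul, Bialgebra.comul_mul, Bialgebra.comul_mul, hs, ht,
        TensorProduct.star_mul_of_starRing]
  star_antipode_star_antipode t := by
    induction t using Universal.induction with
    | ofAction X hX h =>
      rw [antipode_ofAction, star_ofAction, antipode_ofAction, star_ofAction,
        HopfStarAlgebra.star_antipode_star_antipode]
    | algebraMap c =>
      rw [antipode_algebraMap, star_algebraMap, antipode_algebraMap, star_algebraMap, star_star]
    | add s t hs ht => simp only [map_add, star_add, hs, ht]
    | mul s t hs ht => rw [antipode_mul, star_mul, antipode_mul, star_mul, hs, ht]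

/-! #### Action -/

/-- The action of the universal algebra. -/
noncomputable def actHom : Universal P →ₐ[ℂ] Module.End ℂ A := proj .act

theorem actHom_algebraMap (c : ℂ) (a : A) :
    actHom (algebraMap ℂ (Universal P) c) a = c • a := by
  rw [AlgHom.commutes, Module.algebraMap_end_apply]

theorem actHom_mul (s t : Universal P) (a : A) : actHom (s * t) a = actHom s (actHom t a) := by
  rw [map_mul, Module.End.mul_apply]

/-- If all actions with property `P` leave `a` invariant, then so does the universal one. -/
theorem actHom_eq_counit_smul (a : A)
    (ha : ∀ X : GaloisAction A B, P X → ∀ h, X.act h a = Coalgebra.counit (R := ℂ) h • a)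
    (t : Universal P) : actHom t a = Coalgebra.counit (R := ℂ) t • a := by
  induction t using Universal.induction with
  | ofAction X hX h => exact ha X hX h
  | algebraMap c => rw [actHom_algebraMap, Bialgebra.counit_algebraMap]
  | add s t hs ht => rw [map_add, map_add, LinearMap.add_apply, hs, ht, add_smul]
  | mul s t hs ht =>
    rw [actHom_mul, ht, map_smul, hs, Bialgebra.counit_mul, smul_smul, mul_comm]

/-- If all actions with property `P` preserve a functional, then so does the universal one. -/
theorem apply_actHom (τ : A →ₗ[ℂ] ℂ)
    (hτ : ∀ X : GaloisAction A B, P X → ∀ h a, τ (X.act h a) = Coalgebra.counit (R := ℂ) h * τ a)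
    (t : Universal P) : ∀ a, τ (actHom t a) = Coalgebra.counit (R := ℂ) t * τ a := by
  induction t using Universal.induction with
  | ofAction X hX h => exact hτ X hX h
  | algebraMap c =>
    intro a
    rw [actHom_algebraMap, Bialgebra.counit_algebraMap, map_smul, smul_eq_mul]
  | add s t hs ht =>
    intro a
    rw [map_add, map_add, LinearMap.add_apply, map_add, hs, ht, add_mul]
  | mul s t hs ht =>
    intro a
    rw [actHom_mul, hs, ht, Bialgebra.counit_mul, mul_assoc]

/-- The action of tensors on `A ⊗ A`. -/
noncomputable def tensorActHom :
    Universal P ⊗[ℂ] Universal P →ₐ[ℂ] Module.End ℂ (A ⊗[ℂ] A) :=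
  (Module.endTensorEndAlgHom (R := ℂ) (S := ℂ) (A := ℂ) (M := A) (N := A)).comp
    (Algebra.TensorProduct.map actHom actHom)

theorem tensorActHom_tmul (x : Universal P ⊗[ℂ] Universal P) (a b : A) :
    tensorActHom x (a ⊗ₜ b) =
      TensorProduct.map (actHom.toLinearMap.flip a) (actHom.toLinearMap.flip b) x := by
  induction x with
  | zero => simp
  | add x y hx hy => simp only [map_add, LinearMap.add_apply, hx, hy]
  | tmul x y => rfl

/-- As an identity of linear maps, with both `Δ` and the action on `A ⊗ A` multiplicative, the
product case is a composition of two intertwining relations. -/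
theorem actHom_comp_mul (t : Universal P) : actHom t ∘ₗ LinearMap.mul' ℂ A =
    LinearMap.mul' ℂ A ∘ₗ tensorActHom (Coalgebra.comul (R := ℂ) t) := by
  induction t using Universal.induction with
  | ofAction X hX h =>
    ext a b
    refine (X.isModuleStarAlgebra.act_mul h a b).trans ?_
    change _ = LinearMap.mul' ℂ A (tensorActHom _ (a ⊗ₜ b))
    rw [tensorActHom_tmul, comul_ofAction]
    congr 1
    induction Coalgebra.comul (R := ℂ) h with
    | zero => simp
    | add x y hx hy => simp only [map_add, hx, hy]
    | tmul x y => rfl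
  | algebraMap c =>
    rw [Bialgebra.comul_algebraMap, AlgHom.commutes, AlgHom.commutes]
    ext a b
    simp [Module.algebraMap_end_apply]
  | add s t hs ht => rw [map_add, map_add, map_add, LinearMap.add_comp, LinearMap.comp_add, hs, ht]
  | mul s t hs ht =>
    rw [Bialgebra.comul_mul, map_mul, map_mul, Module.End.mul_eq_comp, Module.End.mul_eq_comp,
      LinearMap.comp_assoc, ht, ← LinearMap.comp_assoc, hs, LinearMap.comp_assoc]

theorem isModuleStarAlgebra_actHom : IsModuleStarAlgebra (actHom (P := P)) where
  act_one := actHom_eq_counit_smul 1 fun X _ => X.isModuleStarAlgebra.act_one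
  act_mul t a b := by
    rw [← tensorActHom_tmul]
    exact LinearMap.congr_fun (actHom_comp_mul t) (a ⊗ₜ b)
  star_act t := by
    induction t using Universal.induction with
    | ofAction X hX h => exact X.isModuleStarAlgebra.star_act h
    | algebraMap c =>
      intro a
      rw [antipode_algebraMap, star_algebraMap, actHom_algebraMap, actHom_algebraMap, star_smul]
    | add s t hs ht =>
      intro a
      simp only [map_add, LinearMap.add_apply, star_add, hs, ht]
    | mul s t hs ht =>
      intro a
      -- Antipode and star each reverse products, so together they keep the order.
      rw [actHom_mul, hs, ht, antipode_mul, star_mul, actHom_mul]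

end Universal

/-- The universal object for the actions with property `P`. -/
noncomputable def universal (P : GaloisAction A B → Prop) : GaloisAction A B where
  carrier := Universal P
  act := Universal.actHom
  isModuleStarAlgebra := Universal.isModuleStarAlgebra_actHom
  fixes t b hb := Universal.actHom_eq_counit_smul b (fun X _ h => X.fixes h b hb) t

/-! ### Terminality of the universal action -/

variable {P : GaloisAction A B → Prop}

/-- The morphism from an action with property `P` to the universal one. -/
noncomputable def toUniversal (X : GaloisAction A B) (hX : P X) : X ⟶ universal P where
  toBialgHom := BialgHom.ofAlgHom (Universal.ofAction X hX)
    (Universal.counitHom_comp_ofAction X hX) (Universal.comulHom_comp_ofAction X hX).symm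
  map_star _ := rfl
  act_map _ _ := rfl

/-- On generators this is `coeff_map` for the morphism `toUniversal`. -/
theorem coeff_universal (i : CoefficientIndex) :
    (universal P).coeff i = Universal.proj i :=
  Universal.algHom_ext fun X hX h => coeff_map (toUniversal X hX) i h

/-- The coefficients of `f h` are those of `h`, whatever `f` is, and an element of `Universal P` is
determined by its coefficients. -/
theorem hom_universal_ext {X : GaloisAction A B} (f g : X ⟶ universal P) : f = g := by
  refine Hom.ext (BialgHom.ext fun h => Universal.ext_proj fun i => ?_)
  have hf := coeff_map f i h
  have hg := coeff_map g i h
  rw [coeff_universal] at hf hg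
  exact hf.trans hg.symm

end GaloisAction

theorem mainTheorem1 {H : Type u} [NormedAddCommGroup H] [InnerProductSpace ℂ H] [CompleteSpace H]
    (N M : VonNeumannAlgebra H) (hN : N.IsFiniteFactor) (hM : M.IsFiniteFactor) (hNM : N ≤ M) :
    (∃ Q : GaloisCat N M, IsQGal N M Q) ∧
    ∀ τ : M.toStarSubalgebra →ₗ[ℂ] ℂ, M.IsCanonicalTrace τ →
      ∃ Q : GaloisTraceCat N M τ, IsQGalTrace N M τ Q := by
  refine ⟨⟨GaloisAction.universal fun _ => True, ⟨Limits.IsTerminal.ofUniqueHom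
    (fun X => GaloisAction.toUniversal X trivial) fun _ _ =>
      GaloisAction.hom_universal_ext _ _⟩⟩, fun τ _ => ?_⟩
  -- Preservation of `τ` passes from generators to sums and products, so the universal object lies
  -- in the full subcategory.
  refine ⟨⟨GaloisAction.universal (GaloisAction.Preserves τ),
    GaloisAction.Universal.apply_actHom τ fun _ hX => hX⟩,
    ⟨Limits.IsTerminal.ofUniqueHom
      (fun X => ObjectProperty.homMk (GaloisAction.toUniversal X.obj X.property)) fun _ _ => ?_⟩⟩
  exact ObjectProperty.hom_ext _ (GaloisAction.hom_universal_ext _ _)
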